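/- Consider the $(N,K)$ cache network: a server holds $N$ files $W_1,\dots,W_N$ of $F$ bits each and is connected by an error-free broadcast link to $K$ users, each with its own cache. A caching scheme with caches of $C$ bits consists of cache contents $Z_1,\dots,Z_K\in\{0,1\}^C$, each a function of $(W_1,\dots,W_N)$ and chosen without knowledge of the demand, and, for every demand $d=(d_1,\dots,d_K)\in\{1,\dots,N\}^K$ in which each of the $N$ files is requested by at least one user, a broadcast message $X_d$ of $\ell_d$ bits, a function of $(W_1,\dots,W_N)$, such that for every $k$ the file $W_{d_k}$ is a function of $(Z_k,X_d)$. A pair $(M,R)$ of real numbers is achievable if for every $\varepsilon>0$ and all sufficiently large $F$ there is a scheme with $C\le MF$ and $\ell_d\le (R+\varepsilon)F$ for every such demand $d$. The exact rate memory tradeoff is $R^*(M)=\min\{R:(M,R)\text{ is achievable}\}$. Theorem. Let $K\ge 2$ and $\left\lceil\frac{K+1}{2}\right\rceil\le N\le K$. Then for every real $M$ with $$\frac{N}{K}\left(K-2+\frac{K-2+1/N}{K-1}\right)\le M\le \frac{N(K-1)}{K}$$ the minimum $R^*(M)$ exists and $$R^*(M)=\frac{KN-1}{K(N-1)}-\frac{1}{N-1}\,M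 .$$ -/

import Mathlib

namespace CodedCaching

/-- Strings of `n` bits. -/
abbrev Bits (n : ℕ) : Type := Fin n → Bool

/-- The contents of the server: `N` files of `F` bits each. -/
abbrev Library (N F : ℕ) : Type := Fin N → Bits F

/-- The demand vectors under consideration: user `k` requests file `d k`, and every one of the
`N` files is requested by at least one of the `K` users. -/
abbrev Demand (N K : ℕ) : Type := {d : Fin K → Fin N // Function.Surjective d}

/-- A coded caching scheme for the `(N, K)` cache network, with files of `F` bits and caches of
`C` bits.  The placement does not see the demand, both the cache contents and the broadcast are
arbitrary functions of all the files, and every user recovers the requested file without error,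
whatever the contents of the files. -/
structure Scheme (N K F C : ℕ) where
  /-- the contents of the cache of user `k` -/
  cache : (k : Fin K) → Library N F → Bits C
  /-- the number of bits broadcast in response to the demand `d` -/
  load : Demand N K → ℕ
  /-- the bits broadcast in response to the demand `d` -/
  broadcast : (d : Demand N K) → Library N F → Bits (load d)
  /-- the file computed by user `k`, when the demand is `d`, from its own cache and the
  broadcast -/
  decode : (d : Demand N K) → (k : Fin K) → Bits C → Bits (load d) → Bits F
  decode_eq : ∀ (d : Demand N K) (k : Fin K) (W : Library N F),
    decode d k (cache k W) (broadcast d W) = W (d.1 k)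

/-- The memory rate pair `(M, R)` is achievable for the `(N, K)` cache network: for every `ε > 0`
and all large file sizes `F` there is a scheme with caches of at most `M F` bits that broadcasts
at most `(R + ε) F` bits in response to every demand. -/
def Achievable (N K : ℕ) (M R : ℝ) : Prop :=
  ∀ ε : ℝ, 0 < ε → ∀ᶠ F : ℕ in Filter.atTop, ∃ C : ℕ, (C : ℝ) ≤ M * (F : ℝ) ∧
    ∃ S : Scheme N K F C, ∀ d : Demand N K, (S.load d : ℝ) ≤ (R + ε) * (F : ℝ)

/-- `R` is the exact rate memory tradeoff `R*(M) = min {R : (M, R) is achievable}` of the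
`(N, K)` cache network at the cache size `M`. -/
def IsExactTradeoff (N K : ℕ) (M R : ℝ) : Prop :=
  IsLeast {R' : ℝ | Achievable N K M R'} R

end CodedCaching

/-! The claimed line joins two corner points, so it suffices to achieve both, share memory between
them, and prove one linear converse: `K * (M + (N - 1) * R) ≥ K * N - 1`.

Converse: use only the `K` cyclic shifts of one demand. With the broadcast centred at user `c + m`,
user `c` recovers file `m` if `m < N` and file `K - m` otherwise. As `K < 2 * N`, the latter lies
between `1` and `N - 1`, so the nonzero files can often be recovered at two offsets, and file `0` at
offset `0` only. Let `H c L` be the entropy of the nonzero files, cache `c` and the broadcasts at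
offsets `1, ..., L`. Submodularity bounds `H c k + H c L` above when `k + L = K - 1`
(`jointEntropy_pair_le_of_le`). Adding broadcast `c` to cache `c` reveals file `0`; this gives an
inequality that telescopes after averaging over `c` (`entropy_bot_add_le`, `le_sum_jointEntropy`).
Comparing the two bounds on the sum of all `H c L` gives `Scheme.lower_bound`.

Achievability: the right endpoint, of rate `1 / K`, comes from uncoded placement
(`hasScheme_one_bit`). The left endpoint, of rate `1 / (K - 1)`, comes from placement coded across
files over the field with four elements (`hasScheme_two_mul`). There one stored sum of symbols over
all files, compared with a broadcast combination, isolates a symbol of the requested file. -/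

namespace CodedCaching

/-! ### Entropy of partitions of a finite set (finer partitions are smaller setoids) -/

section Entropy

variable {Ω : Type*} [Fintype Ω]

open Classical in
/-- The number of elements equivalent to `x`. -/
noncomputable def classCard (r : Setoid Ω) (x : Ω) : ℕ :=
  (Finset.univ.filter fun y => r x y).card

/-- The Shannon entropy (in nats) of the partition `r` under the uniform distribution,
multiplied by the number of outcomes. -/
noncomputable def entropy (r : Setoid Ω) : ℝ :=
  ∑ x, (Real.log (Fintype.card Ω) - Real.log (classCard r x))

theorem classCard_pos (r : Setoid Ω) (x : Ω) : 0 < classCard r x :=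
  Finset.card_pos.2 ⟨x, by simp⟩

theorem classCard_congr {r : Setoid Ω} {x y : Ω} (h : r x y) : classCard r x = classCard r y := by
  unfold classCard
  congr 1
  ext z
  simp only [Finset.mem_filter, Finset.mem_univ, true_and]
  exact ⟨fun hz => r.trans (r.symm h) hz, fun hz => r.trans h hz⟩

theorem classCard_mono {r s : Setoid Ω} (h : r ≤ s) (x : Ω) : classCard r x ≤ classCard s x := by
  classical
  refine Finset.card_le_card fun y hy => ?_
  simp only [Finset.mem_filter, Finset.mem_univ, true_and] at hy ⊢
  exact h hy

theorem classCard_top (x : Ω) : classCard (⊤ : Setoid Ω) x = Fintype.card Ω := by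
  classical
  unfold classCard
  rw [Finset.filter_true_of_mem fun y _ => by trivial]
  rfl

theorem classCard_bot (x : Ω) : classCard (⊥ : Setoid Ω) x = 1 := by
  classical
  unfold classCard
  rw [Finset.card_eq_one]
  exact ⟨x, by ext y; simp [eq_comm]⟩

theorem entropy_anti {r s : Setoid Ω} (h : r ≤ s) : entropy s ≤ entropy r := by
  refine Finset.sum_le_sum fun x _ => ?_
  have := Real.log_le_log (by exact_mod_cast classCard_pos r x)
    (by exact_mod_cast classCard_mono h x : (classCard r x : ℝ) ≤ classCard s x)
  linarith

theorem entropy_top : entropy (⊤ : Setoid Ω) = 0 := by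
  simp [entropy, classCard_top]

theorem entropy_bot : entropy (⊥ : Setoid Ω) = Fintype.card Ω * Real.log (Fintype.card Ω) := by
  simp [entropy, classCard_bot]

/-- The elements equivalent to `y` under `r` and to `z` under `s` form a class of `r ⊓ s`, or
there are none. -/
theorem sum_inv_classCard_le {r s t : Setoid Ω} (hr : r ≤ t) (hs : s ≤ t) (y z : Ω)
    [DecidablePred fun x => r x y ∧ s x z] [Decidable (t y z)] :
    ∑ x with r x y ∧ s x z, ((classCard (r ⊓ s) x : ℝ) * classCard t x)⁻¹
      ≤ if t y z then (classCard t y : ℝ)⁻¹ else 0 := by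
  classical
  by_cases hne : ∃ x, r x y ∧ s x z
  · obtain ⟨x₀, hy, hz⟩ := hne
    rw [if_pos (t.trans (t.symm (hr hy)) (hs hz))]
    have hset : (Finset.univ.filter fun x => r x y ∧ s x z)
        = Finset.univ.filter fun x => (r ⊓ s) x₀ x := by
      ext x
      simp only [Finset.mem_filter, Finset.mem_univ, true_and]
      exact ⟨fun h => ⟨r.trans hy (r.symm h.1), s.trans hz (s.symm h.2)⟩,
        fun h => ⟨r.trans (r.symm h.1) hy, s.trans (s.symm h.2) hz⟩⟩
    rw [hset]
    have hconst : ∀ x ∈ Finset.univ.filter (fun x => (r ⊓ s) x₀ x),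
        ((classCard (r ⊓ s) x : ℝ) * classCard t x)⁻¹
          = ((classCard (r ⊓ s) x₀ : ℝ) * classCard t y)⁻¹ := by
      intro x hx
      simp only [Finset.mem_filter, Finset.mem_univ, true_and] at hx
      rw [← classCard_congr hx, ← classCard_congr (hr hy),
        classCard_congr (r := t) (hr (Setoid.inf_iff_and.1 hx).1)]
    rw [Finset.sum_congr rfl hconst, Finset.sum_const, nsmul_eq_mul]
    have h1 : (classCard (r ⊓ s) x₀ : ℝ) ≠ 0 := by exact_mod_cast (classCard_pos _ _).ne'
    change (classCard (r ⊓ s) x₀ : ℝ) * _ ≤ _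
    rw [mul_inv, mul_inv_cancel_left₀ h1]
  · push Not at hne
    rw [Finset.filter_false_of_mem fun x _ h => hne x h.1 h.2, Finset.sum_empty]
    split_ifs <;> positivity

/-- Double counting: the numerator counts pairs `(y, z)` with `r x y` and `s x z`. After exchanging
sums, each pair contributes at most `1 / classCard t y`, and only if `t y z`; each `y` then
contributes at most `1`. -/
theorem sum_classCard_ratio_le {r s t : Setoid Ω} (hr : r ≤ t) (hs : s ≤ t) :
    ∑ x, (classCard r x : ℝ) * classCard s x / (classCard (r ⊓ s) x * classCard t x)
      ≤ Fintype.card Ω := by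
  classical
  have hterm : ∀ x, (classCard r x : ℝ) * classCard s x / (classCard (r ⊓ s) x * classCard t x)
      = ∑ y, ∑ z, if r x y ∧ s x z then ((classCard (r ⊓ s) x : ℝ) * classCard t x)⁻¹ else 0 := by
    intro x
    rw [div_eq_mul_inv]
    simp only [ite_and]
    have hr' : (classCard r x : ℝ) = ∑ y, if r x y then (1 : ℝ) else 0 := by
      rw [Finset.sum_boole]; unfold classCard; congr!
    have hs' : (classCard s x : ℝ) = ∑ z, if s x z then (1 : ℝ) else 0 := by
      rw [Finset.sum_boole]; unfold classCard; congr!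
    rw [hr', hs', Finset.sum_mul_sum, Finset.sum_mul]
    refine Finset.sum_congr rfl fun y _ => ?_
    rw [Finset.sum_mul]
    refine Finset.sum_congr rfl fun z _ => ?_
    split_ifs <;> simp
  calc _ = ∑ y, ∑ z, ∑ x with r x y ∧ s x z, ((classCard (r ⊓ s) x : ℝ) * classCard t x)⁻¹ := by
        simp only [hterm]
        rw [Finset.sum_comm]
        refine Finset.sum_congr rfl fun y _ => ?_
        rw [Finset.sum_comm]
        refine Finset.sum_congr rfl fun z _ => ?_
        rw [Finset.sum_filter]
    _ ≤ ∑ y, ∑ z, if t y z then (classCard t y : ℝ)⁻¹ else 0 :=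
        Finset.sum_le_sum fun y _ => Finset.sum_le_sum fun z _ => sum_inv_classCard_le hr hs y z
    _ = Fintype.card Ω := by
        have : ∀ y : Ω, (∑ z, if t y z then (classCard t y : ℝ)⁻¹ else 0) = 1 := by
          intro y
          rw [← Finset.sum_filter, Finset.sum_const, nsmul_eq_mul]
          change (classCard t y : ℝ) * _ = 1
          exact mul_inv_cancel₀ (by exact_mod_cast (classCard_pos t y).ne')
        simp [this]

/-- Submodularity of entropy. -/
theorem entropy_submodular {r s t : Setoid Ω} (hr : r ≤ t) (hs : s ≤ t) :
    entropy (r ⊓ s) + entropy t ≤ entropy r + entropy s := by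
  have hpos : ∀ (u : Setoid Ω) (x : Ω), (0 : ℝ) < classCard u x := fun u x => by
    exact_mod_cast classCard_pos u x
  -- Nonnegativity of conditional mutual information, by `log a ≤ a - 1` applied pointwise to the
  -- ratio.
  have hlog : ∀ x, Real.log (classCard r x) + Real.log (classCard s x)
      - Real.log (classCard (r ⊓ s) x) - Real.log (classCard t x)
      ≤ (classCard r x : ℝ) * classCard s x / (classCard (r ⊓ s) x * classCard t x) - 1 := by
    intro x
    have h := Real.log_le_sub_one_of_pos
      (div_pos (mul_pos (hpos r x) (hpos s x)) (mul_pos (hpos (r ⊓ s) x) (hpos t x)))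
    rw [Real.log_div (mul_pos (hpos r x) (hpos s x)).ne'
      (mul_pos (hpos (r ⊓ s) x) (hpos t x)).ne', Real.log_mul (hpos _ _).ne' (hpos _ _).ne',
      Real.log_mul (hpos _ _).ne' (hpos _ _).ne'] at h
    linarith
  have hsum := Finset.sum_le_sum fun x (_ : x ∈ Finset.univ) => hlog x
  have hratio := sum_classCard_ratio_le hr hs
  simp only [Finset.sum_sub_distrib, Finset.sum_add_distrib, Finset.sum_const, nsmul_eq_mul,
    Finset.card_univ, mul_one] at hsum
  simp only [entropy, Finset.sum_sub_distrib]
  linarith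

theorem entropy_inf_le (r s : Setoid Ω) : entropy (r ⊓ s) ≤ entropy r + entropy s := by
  simpa [entropy_top] using entropy_submodular (t := ⊤) (le_top (a := r)) (le_top (a := s))

theorem entropy_biInf_le {ι : Type*} (r : ι → Setoid Ω) (s : Finset ι) :
    entropy (⨅ i ∈ s, r i) ≤ ∑ i ∈ s, entropy (r i) := by
  classical
  induction s using Finset.induction_on with
  | empty => simp [entropy_top]
  | insert a s ha ih =>
    rw [Finset.iInf_insert, Finset.sum_insert ha]
    exact (entropy_inf_le _ _).trans (by gcongr)

/-- The entropy of a function is at most the logarithm of the size of its codomain. -/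
theorem entropy_ker_le {β : Type*} [Fintype β] (f : Ω → β) :
    entropy (Setoid.ker f) ≤ Fintype.card Ω * Real.log (Fintype.card β) := by
  classical
  cases isEmpty_or_nonempty Ω with
  | inl h => simp [entropy]
  | inr h =>
  have hβ : 0 < (Fintype.card β : ℝ) := by
    exact_mod_cast Fintype.card_pos_iff.2 ⟨f (Classical.arbitrary Ω)⟩
  have hΩ : 0 < (Fintype.card Ω : ℝ) := by exact_mod_cast Fintype.card_pos
  set c := classCard (Setoid.ker f) with hc
  have hpos : ∀ x, (0 : ℝ) < c x := fun x => by exact_mod_cast classCard_pos _ x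
  -- Each nonempty fibre of `f` contributes exactly `1`.
  have hsum : ∑ x, (c x : ℝ)⁻¹ ≤ Fintype.card β := by
    rw [← Finset.sum_fiberwise Finset.univ f]
    calc _ ≤ ∑ _b : β, (1 : ℝ) := ?_
      _ = _ := by simp
    refine Finset.sum_le_sum fun b _ => ?_
    have hcb : ∀ x ∈ Finset.univ.filter (fun x => f x = b),
        (c x : ℝ)⁻¹ = ((Finset.univ.filter fun x => f x = b).card : ℝ)⁻¹ := by
      intro x hx
      simp only [Finset.mem_filter, Finset.mem_univ, true_and] at hx
      rw [hc]
      unfold classCard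
      congr 3
      ext y
      simp [Setoid.ker_def, hx, eq_comm]
    rw [Finset.sum_congr rfl hcb, Finset.sum_const, nsmul_eq_mul]
    exact mul_inv_le_one
  have hlog : ∀ x, Real.log (Fintype.card Ω) - Real.log (c x)
      ≤ Real.log (Fintype.card β) + (Fintype.card Ω / Fintype.card β * (c x : ℝ)⁻¹ - 1) := by
    intro x
    have h := Real.log_le_sub_one_of_pos (div_pos hΩ (mul_pos hβ (hpos x)))
    rw [Real.log_div hΩ.ne' (mul_pos hβ (hpos x)).ne', Real.log_mul hβ.ne' (hpos x).ne'] at h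
    have : (Fintype.card Ω : ℝ) / (Fintype.card β * c x)
        = Fintype.card Ω / Fintype.card β * (c x : ℝ)⁻¹ := by field_simp
    linarith
  calc entropy (Setoid.ker f) ≤ _ := Finset.sum_le_sum fun x _ => hlog x
    _ = Fintype.card Ω * Real.log (Fintype.card β)
        + (Fintype.card Ω / Fintype.card β * ∑ x, (c x : ℝ)⁻¹ - Fintype.card Ω) := by
      simp [Finset.sum_add_distrib, Finset.sum_sub_distrib, Finset.mul_sum]
    _ ≤ _ := by
      have : (Fintype.card Ω : ℝ) / Fintype.card β * ∑ x, (c x : ℝ)⁻¹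
          ≤ Fintype.card Ω / Fintype.card β * Fintype.card β := by gcongr
      rw [div_mul_cancel₀ _ hβ.ne'] at this
      linarith

end Entropy

/-! ### Converse: cyclic demands and the entropy chain -/

/-- User `k` requests file `cyclicFile N K m` in the demand centred at user `k + m`. -/
def cyclicFile (N K m : ℕ) : ℕ := if m < N then m else K - m

theorem cyclicFile_lt {N K m : ℕ} (hK : K < 2 * N) : cyclicFile N K m < N := by
  unfold cyclicFile
  split_ifs <;> omega

/-- The demand in which user `k` requests the file `cyclicFile N K (i - k)`. -/
def cyclicDemand {N K : ℕ} (hNK : N ≤ K) (hK : K < 2 * N) (i : Fin K) :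
    Demand N K :=
  ⟨fun k => ⟨cyclicFile N K (i - k).val, cyclicFile_lt hK⟩, by
    have : NeZero K := ⟨by omega⟩
    intro n
    refine ⟨i - ⟨n.val, by omega⟩, Fin.ext ?_⟩
    have : i - (i - ⟨n.val, by omega⟩ : Fin K) = ⟨n.val, by omega⟩ := by abel
    simp [this, cyclicFile]⟩

section Chain

variable {Ω : Type*} {N K : ℕ} [NeZero K]

/-- The joint partition of the `t (c + m)`, `m ∈ s`. -/
def joint (t : Fin K → Setoid Ω) (c : Fin K) (s : Finset ℕ) : Setoid Ω :=
  ⨅ m ∈ s, t (c + Fin.ofNat K m)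

theorem joint_anti (t : Fin K → Setoid Ω) (c : Fin K) {s s' : Finset ℕ} (h : s ⊆ s') :
    joint t c s' ≤ joint t c s :=
  biInf_mono fun _ hm => h hm

theorem joint_union (t : Fin K → Setoid Ω) (c : Fin K) (s s' : Finset ℕ) :
    joint t c (s ∪ s') = joint t c s ⊓ joint t c s' :=
  Finset.iInf_union

theorem joint_le (t : Fin K → Setoid Ω) (c : Fin K) {s : Finset ℕ} {m : ℕ} (hm : m ∈ s) :
    joint t c s ≤ t (c + Fin.ofNat K m) :=
  biInf_le _ hm

theorem joint_shift (t : Fin K → Setoid Ω) (c : Fin K) (L : ℕ) :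
    joint t (c + 1) (Finset.range L) = joint t c (Finset.Icc 1 L) := by
  have h : Finset.Icc 1 L = (Finset.range L).image (· + 1) := by
    ext m
    simp only [Finset.mem_Icc, Finset.mem_image, Finset.mem_range]
    exact ⟨fun h => ⟨m - 1, by omega⟩, by rintro ⟨i, hi, rfl⟩; omega⟩
  have h1 : ∀ m : ℕ, Fin.ofNat K (m + 1) = 1 + Fin.ofNat K m := by
    intro m
    ext
    simp [Fin.val_add, add_comm]
  unfold joint
  rw [h, Finset.iInf_finset_image]
  simp only [h1, add_assoc]

/-- The joint partition of all files but the first. -/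
def otherFiles (w : Fin N → Setoid Ω) : Setoid Ω :=
  ⨅ n : Fin N, ⨅ _ : n.val ≠ 0, w n

variable [Fintype Ω]

/-- The entropy of all files but the first, the cache of user `c`, and the broadcasts centred at
the next `L` users. -/
noncomputable def jointEntropy (w : Fin N → Setoid Ω) (z t : Fin K → Setoid Ω) (c : Fin K)
    (L : ℕ) : ℝ :=
  entropy (otherFiles w ⊓ z c ⊓ joint t c (Finset.Icc 1 L))

variable {w : Fin N → Setoid Ω} {z t : Fin K → Setoid Ω}
  (hdec : ∀ (c : Fin K) (m : ℕ) (n : Fin N), m < K → n.val = cyclicFile N K m →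
    z c ⊓ t (c + Fin.ofNat K m) ≤ w n)
include hdec

/-- Cache `c` and the broadcasts at offsets in `s` already determine every nonzero file, so these
files add no entropy and subadditivity suffices. -/
theorem entropy_le_of_covers {zb tb : ℝ} (hz : ∀ c, entropy (z c) ≤ zb)
    (ht : ∀ c, entropy (t c) ≤ tb) (htb : 0 ≤ tb) {s : Finset ℕ} (hsK : ∀ m ∈ s, m < K)
    (hcard : s.card ≤ N - 1)
    (hs : ∀ n, n < N → n ≠ 0 → ∃ m ∈ s, cyclicFile N K m = n) (c : Fin K) :
    entropy (otherFiles w ⊓ z c ⊓ joint t c s) ≤ zb + ((N - 1 : ℕ) : ℝ) * tb := by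
  have hle : z c ⊓ joint t c s ≤ otherFiles w := by
    refine le_iInf fun n => le_iInf fun hn => ?_
    obtain ⟨m, hm, hmn⟩ := hs n.val n.2 hn
    exact (inf_le_inf_left _ (joint_le t c hm)).trans (hdec c m n (hsK m hm) hmn.symm)
  rw [inf_assoc, inf_eq_right.2 hle]
  calc _ ≤ entropy (z c) + entropy (joint t c s) := entropy_inf_le _ _
    _ ≤ zb + ∑ _m ∈ s, tb :=
      add_le_add (hz c) ((entropy_biInf_le _ s).trans (Finset.sum_le_sum fun _ _ => ht _))
    _ ≤ zb + ((N - 1 : ℕ) : ℝ) * tb := by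
      rw [Finset.sum_const, nsmul_eq_mul]
      gcongr

/-- When `L ≥ N`, two covering sets of `N - 1` offsets are chosen whose union contains `1, ..., L`
and whose intersection contains `1, ..., k`; submodularity then bounds the pair. -/
theorem jointEntropy_pair_le_of_le (hN : 0 < N) (hNK : N ≤ K) (hK : K < 2 * N) {zb tb : ℝ}
    (hz : ∀ c, entropy (z c) ≤ zb) (ht : ∀ c, entropy (t c) ≤ tb) (htb : 0 ≤ tb) (c : Fin K)
    {k L : ℕ} (hkL : k + L + 1 = K) (hle : k ≤ L) :
    jointEntropy w z t c k + jointEntropy w z t c L ≤ 2 * (zb + ((N - 1 : ℕ) : ℝ) * tb) := by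
  have hP : entropy (otherFiles w ⊓ z c ⊓ joint t c (Finset.Icc 1 (N - 1)))
      ≤ zb + ((N - 1 : ℕ) : ℝ) * tb := by
    refine entropy_le_of_covers hdec hz ht htb (fun m hm => ?_) (by simp) (fun n hn hn0 => ?_) c
    · rw [Finset.mem_Icc] at hm; omega
    · exact ⟨n, Finset.mem_Icc.2 (by omega), if_pos hn⟩
  by_cases hL : L < N
  · have hmono : ∀ i < N, jointEntropy w z t c i ≤ zb + ((N - 1 : ℕ) : ℝ) * tb := fun i hi =>
      (entropy_anti (inf_le_inf_left _
        (joint_anti t c (Finset.Icc_subset_Icc_right (by omega))))).trans hP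
    linarith [hmono k (by omega), hmono L hL]
  · have hQ : entropy (otherFiles w ⊓ z c ⊓
          joint t c (Finset.Icc 1 k ∪ Finset.Icc (K - N + 1) L))
        ≤ zb + ((N - 1 : ℕ) : ℝ) * tb := by
      refine entropy_le_of_covers hdec hz ht htb (fun m hm => ?_) ?_ (fun n hn hn0 => ?_) c
      · rw [Finset.mem_union, Finset.mem_Icc, Finset.mem_Icc] at hm; omega
      · refine (Finset.card_union_le _ _).trans ?_
        rw [Nat.card_Icc, Nat.card_Icc]
        omega
      -- The files missing from offsets `n` are recovered at the mirrored offsets `K - n`, which lie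
      -- in `[N, L]` because `k + L + 1 = K`.
      · by_cases hnk : k < n ∧ n ≤ K - N
        · refine ⟨K - n, ?_, ?_⟩
          · rw [Finset.mem_union, Finset.mem_Icc, Finset.mem_Icc]; omega
          · unfold cyclicFile
            split_ifs <;> omega
        · refine ⟨n, ?_, if_pos hn⟩
          rw [Finset.mem_union, Finset.mem_Icc, Finset.mem_Icc]; omega
    have hsub := entropy_submodular
      (t := otherFiles w ⊓ z c ⊓ joint t c (Finset.Icc 1 k))
      (inf_le_inf_left (otherFiles w ⊓ z c) (joint_anti t c
        (show Finset.Icc 1 k ⊆ Finset.Icc 1 (N - 1) from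
          Finset.Icc_subset_Icc_right (by omega))))
      (inf_le_inf_left (otherFiles w ⊓ z c) (joint_anti t c
        (Finset.subset_union_left (s₁ := Finset.Icc 1 k) (s₂ := Finset.Icc (K - N + 1) L))))
    rw [← inf_inf_distrib_left, ← joint_union] at hsub
    -- No gap between the two intervals: `K - N + 1 ≤ N` since `K < 2 * N`.
    have hlast : jointEntropy w z t c L ≤ entropy (otherFiles w ⊓ z c ⊓ joint t c
        (Finset.Icc 1 (N - 1) ∪ (Finset.Icc 1 k ∪ Finset.Icc (K - N + 1) L))) := by
      refine entropy_anti (inf_le_inf_left _ (joint_anti t c fun m hm => ?_))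
      simp only [Finset.mem_union, Finset.mem_Icc] at hm ⊢
      omega
    change entropy _ + _ ≤ _
    linarith

theorem jointEntropy_pair_le (hN : 0 < N) (hNK : N ≤ K) (hK : K < 2 * N) {zb tb : ℝ}
    (hz : ∀ c, entropy (z c) ≤ zb) (ht : ∀ c, entropy (t c) ≤ tb) (htb : 0 ≤ tb) (c : Fin K)
    {k L : ℕ} (hkL : k + L + 1 = K) :
    jointEntropy w z t c k + jointEntropy w z t c L ≤ 2 * (zb + ((N - 1 : ℕ) : ℝ) * tb) := by
  rcases le_total k L with h | h
  · exact jointEntropy_pair_le_of_le hdec hN hNK hK hz ht htb c hkL h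
  · rw [add_comm]
    exact jointEntropy_pair_le_of_le hdec hN hNK hK hz ht htb c (by omega) h

theorem sum_jointEntropy_le (hN : 0 < N) (hNK : N ≤ K) (hK : K < 2 * N) {zb tb : ℝ}
    (hz : ∀ c, entropy (z c) ≤ zb) (ht : ∀ c, entropy (t c) ≤ tb) (htb : 0 ≤ tb) :
    ∑ L ∈ Finset.range K, ∑ c, jointEntropy w z t c L
      ≤ K * K * (zb + ((N - 1 : ℕ) : ℝ) * tb) := by
  have hrefl := Finset.sum_range_reflect (fun L => ∑ c, jointEntropy w z t c L) K
  have h : ∑ L ∈ Finset.range K, (∑ c, jointEntropy w z t c L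
      + ∑ c, jointEntropy w z t c (K - 1 - L))
      ≤ ∑ L ∈ Finset.range K, ∑ _c : Fin K, 2 * (zb + ((N - 1 : ℕ) : ℝ) * tb) := by
    refine Finset.sum_le_sum fun L hL => ?_
    rw [← Finset.sum_add_distrib]
    refine Finset.sum_le_sum fun c _ => ?_
    rw [Finset.mem_range] at hL
    exact jointEntropy_pair_le hdec hN hNK hK hz ht htb c (by omega)
  rw [Finset.sum_add_distrib, hrefl] at h
  simp only [Finset.sum_const, Finset.card_univ, Fintype.card_fin, Finset.card_range,
    nsmul_eq_mul] at h
  linarith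

/-- Cache `c` with broadcast `c` (offset `0`) yields file `0`, so the two collections on the right
jointly determine the whole library; both contain the nonzero files and the broadcasts at offsets
`1, ..., L`. -/
theorem entropy_bot_add_le (hN : 0 < N) (hw : ⨅ n, w n = ⊥) (c : Fin K) {L : ℕ} :
    entropy (⊥ : Setoid Ω) + entropy (otherFiles w ⊓ joint t c (Finset.Icc 1 L))
      ≤ jointEntropy w z t c L
        + entropy (otherFiles w ⊓ joint t c (Finset.range (L + 1))) := by
  have hbot : (otherFiles w ⊓ z c ⊓ joint t c (Finset.Icc 1 L))
      ⊓ (otherFiles w ⊓ joint t c (Finset.range (L + 1))) ≤ ⊥ := by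
    rw [← hw]
    refine le_iInf fun n => ?_
    by_cases hn : n.val = 0
    · refine le_trans ?_ (hdec c 0 n (Nat.pos_of_ne_zero (NeZero.ne K))
        (by simp [cyclicFile, hN, hn]))
      exact le_inf ((inf_le_left.trans inf_le_left).trans inf_le_right)
        ((inf_le_right.trans inf_le_right).trans (joint_le t c (by simp)))
    · exact (inf_le_right.trans inf_le_left).trans ((iInf_le _ n).trans (iInf_le _ hn))
  have hsub := entropy_submodular
    (r := otherFiles w ⊓ z c ⊓ joint t c (Finset.Icc 1 L))
    (s := otherFiles w ⊓ joint t c (Finset.range (L + 1)))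
    (t := otherFiles w ⊓ joint t c (Finset.Icc 1 L))
    (inf_le_inf_right _ inf_le_left)
    (inf_le_inf_left _ (joint_anti t c fun m hm => by
      rw [Finset.mem_Icc] at hm; rw [Finset.mem_range]; omega))
  rw [le_bot_iff.1 hbot] at hsub
  exact hsub

/-- Summed over `c`, a window of `l` broadcasts has the same total entropy wherever it starts, so
`entropy_bot_add_le` telescopes in `g`. The final term `g L` is absorbed by the summand `l = L`. -/
theorem le_sum_jointEntropy (hN : 0 < N) (hw : ⨅ n, w n = ⊥) (L : ℕ) :
    K * L * entropy (⊥ : Setoid Ω) + K * entropy (otherFiles w)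
      ≤ ∑ l ∈ Finset.range (L + 1), ∑ c, jointEntropy w z t c l := by
  set g : ℕ → ℝ := fun l => ∑ c, entropy (otherFiles w ⊓ joint t c (Finset.range l)) with hg
  have hshift : ∀ l, ∑ c, entropy (otherFiles w ⊓ joint t c (Finset.Icc 1 l)) = g l := by
    intro l
    rw [hg]
    simp only [← joint_shift]
    exact Equiv.sum_comp (Equiv.addRight (1 : Fin K))
      fun c => entropy (otherFiles w ⊓ joint t c (Finset.range l))
  have hstep : ∀ l, K * entropy (⊥ : Setoid Ω) + g l
      ≤ ∑ c, jointEntropy w z t c l + g (l + 1) := by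
    intro l
    rw [← hshift l, hg, ← Finset.sum_add_distrib]
    refine le_trans (le_of_eq ?_) (Finset.sum_le_sum fun c _ =>
      entropy_bot_add_le hdec hN hw c (L := l))
    simp [Finset.sum_add_distrib]
  have hg0 : g 0 = K * entropy (otherFiles w) := by
    simp [hg, joint]
  have hsum : ∀ L, K * L * entropy (⊥ : Setoid Ω) + K * entropy (otherFiles w)
      ≤ ∑ l ∈ Finset.range L, ∑ c, jointEntropy w z t c l + g L := by
    intro L
    induction L with
    | zero => simp [hg0]
    | succ L ih =>
      rw [Finset.sum_range_succ]
      push_cast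
      linarith [hstep L]
  rw [Finset.sum_range_succ]
  refine (hsum L).trans (add_le_add le_rfl ?_)
  rw [← hshift L]
  exact Finset.sum_le_sum fun c _ => entropy_anti (inf_le_inf_right _ inf_le_left)

end Chain

/-- The tradeoff between cache size and load that every scheme obeys. -/
theorem Scheme.lower_bound {N K F C L : ℕ} (S : Scheme N K F C) (hN : 0 < N) (hNK : N ≤ K)
    (hK : K < 2 * N) (hL : ∀ d, S.load d ≤ L) :
    ((K : ℝ) * N - 1) * F ≤ K * (C + ((N : ℝ) - 1) * L) := by
  have : NeZero K := ⟨by omega⟩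
  set w : Fin N → Setoid (Library N F) := fun n => Setoid.ker fun W => W n with hwdef
  set z : Fin K → Setoid (Library N F) := fun k => Setoid.ker (S.cache k) with hzdef
  set t : Fin K → Setoid (Library N F) :=
    fun i => Setoid.ker (S.broadcast (cyclicDemand hNK hK i)) with htdef
  set u : ℝ := Fintype.card (Library N F) * Real.log 2 with hu
  have hupos : 0 < u := mul_pos (by exact_mod_cast Fintype.card_pos) (Real.log_pos (by norm_num))
  have hbits : ∀ {n : ℕ} (f : Library N F → Bits n), entropy (Setoid.ker f) ≤ n * u := by
    intro n f
    refine (entropy_ker_le f).trans (le_of_eq ?_)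
    rw [show Fintype.card (Bits n) = 2 ^ n by simp, hu]
    push_cast
    rw [Real.log_pow]
    ring
  have hdec : ∀ (c : Fin K) (m : ℕ) (n : Fin N), m < K → n.val = cyclicFile N K m →
      z c ⊓ t (c + Fin.ofNat K m) ≤ w n := by
    intro c m n hm hn W W' hW
    obtain ⟨hzW, htW⟩ := Setoid.inf_iff_and.1 hW
    have hzW' : S.cache c W = S.cache c W' := hzW
    have htW' : S.broadcast (cyclicDemand hNK hK (c + Fin.ofNat K m)) W
      = S.broadcast (cyclicDemand hNK hK (c + Fin.ofNat K m)) W' := htW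
    have hn' : (cyclicDemand hNK hK (c + Fin.ofNat K m)).1 c = n := by
      refine Fin.ext ?_
      simp [cyclicDemand, hn, Nat.mod_eq_of_lt hm]
    have h1 := S.decode_eq (cyclicDemand hNK hK (c + Fin.ofNat K m)) c W
    have h2 := S.decode_eq (cyclicDemand hNK hK (c + Fin.ofNat K m)) c W'
    rw [hzW', htW', h2, hn'] at h1
    exact h1.symm
  have hw : ⨅ n, w n = ⊥ := by
    refine le_bot_iff.1 fun W W' h => ?_
    exact funext fun n => (iInf_le w n : iInf w ≤ w n) h
  have hbot : entropy (⊥ : Setoid (Library N F)) = N * F * u := by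
    rw [entropy_bot, hu]
    have : (Fintype.card (Library N F) : ℝ) = 2 ^ (F * N) := by
      simp [pow_mul]
    nth_rewrite 2 [this]
    rw [Real.log_pow]
    push_cast
    ring
  have hothers : ((N : ℝ) - 1) * F * u ≤ entropy (otherFiles w) := by
    have hle : otherFiles w ⊓ w ⟨0, hN⟩ ≤ ⊥ := by
      rw [← hw]
      refine le_iInf fun n => ?_
      by_cases hn : n.val = 0
      · rw [show n = ⟨0, hN⟩ from Fin.ext hn]; exact inf_le_right
      · exact inf_le_left.trans ((iInf_le _ n).trans (iInf_le _ hn))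
    have h := (entropy_anti hle).trans (entropy_inf_le _ _)
    have h' := hbits fun W : Library N F => W ⟨0, hN⟩
    rw [hbot] at h
    linarith
  have hupper := sum_jointEntropy_le hdec hN hNK hK (zb := C * u) (tb := L * u)
    (fun c => hbits _) (fun i => (hbits _).trans (by gcongr; exact hL _)) (by positivity)
  -- With `L = K - 1` both bounds concern the same sum, and `(K - 1) * N + (N - 1) = K * N - 1`
  -- gives the constant.
  have hlower := le_sum_jointEntropy hdec hN hw (K - 1)
  rw [show K - 1 + 1 = K by omega] at hlower
  have hKpos : (0 : ℝ) < K := by exact_mod_cast (by omega : 0 < K)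
  have hmain := hlower.trans hupper
  rw [hbot, Nat.cast_pred (by omega), Nat.cast_pred hN] at hmain
  have hfinal : (K * u) * (((K : ℝ) * N - 1) * F) ≤ (K * u) * (K * (C + ((N : ℝ) - 1) * L)) := by
    have : (K : ℝ) * (((N : ℝ) - 1) * F * u) ≤ K * entropy (otherFiles w) := by gcongr
    linarith
  exact le_of_mul_le_mul_left hfinal (by positivity)

/-! ### Achievability: combining schemes and memory sharing -/

/-- There is a scheme for files of `F` bits and caches of `C` bits that broadcasts `L` bits in
response to every demand. -/
def HasScheme (N K F C L : ℕ) : Prop :=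
  ∃ (Z : Fin K → Library N F → Bits C) (X : Demand N K → Library N F → Bits L),
    ∀ (d : Demand N K) (k : Fin K) (W W' : Library N F),
      Z k W = Z k W' → X d W = X d W' → W (d.1 k) = W' (d.1 k)

/-- The decoder picks any library consistent with what the user sees; all of them agree on the
requested file. -/
theorem HasScheme.exists_scheme {N K F C L : ℕ} (h : HasScheme N K F C L) :
    ∃ S : Scheme N K F C, ∀ d, S.load d = L := by
  classical
  obtain ⟨Z, X, hZX⟩ := h
  refine ⟨⟨Z, fun _ => L, X, fun d k z x =>
    if h : ∃ W, Z k W = z ∧ X d W = x then h.choose (d.1 k) else fun _ => false, ?_⟩, fun _ => rfl⟩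
  intro d k W
  have h : ∃ W', Z k W' = Z k W ∧ X d W' = X d W := ⟨W, rfl, rfl⟩
  rw [dif_pos h]
  exact hZX d k _ _ h.choose_spec.1 h.choose_spec.2

/-- A scheme over arbitrary finite alphabets, with additive placement and broadcast, in which
every user recovers the requested file. -/
theorem HasScheme.of_additive {N K F C L : ℕ} {A B : Type} {D : Fin K → Type} [AddCommGroup A]
    [AddCommGroup B] [∀ k, AddCommGroup (D k)] [Finite A] [Finite B] [∀ k, Finite (D k)]
    (hA : 2 ^ F ≤ Nat.card A) (hB : Nat.card B ≤ 2 ^ L) (hD : ∀ k, Nat.card (D k) ≤ 2 ^ C)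
    (Z : (k : Fin K) → (Fin N → A) →+ D k) (X : Demand N K → (Fin N → A) →+ B)
    (h : ∀ (d : Demand N K) (k : Fin K) (W : Fin N → A), Z k W = 0 → X d W = 0 → W (d.1 k) = 0) :
    HasScheme N K F C L := by
  have := Fintype.ofFinite A
  have := Fintype.ofFinite B
  have := fun k => Fintype.ofFinite (D k)
  simp only [Nat.card_eq_fintype_card] at hA hB hD
  obtain ⟨a⟩ := Function.Embedding.nonempty_of_card_le
    (show Fintype.card (Bits F) ≤ Fintype.card A by simpa using hA)
  obtain ⟨b⟩ := Function.Embedding.nonempty_of_card_le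
    (show Fintype.card B ≤ Fintype.card (Bits L) by simpa using hB)
  have hc : ∀ k, Nonempty (D k ↪ Bits C) := fun k =>
    Function.Embedding.nonempty_of_card_le (by simpa using hD k)
  have c := fun k => (hc k).some
  refine ⟨fun k W => c k (Z k fun n => a (W n)), fun d W => b (X d fun n => a (W n)), ?_⟩
  intro d k W W' hZ hX
  have := h d k ((fun n => a (W n)) - fun n => a (W' n))
    (by rw [map_sub, (c k).injective hZ, sub_self]) (by rw [map_sub, b.injective hX, sub_self])
  exact a.injective (sub_eq_zero.1 this)

theorem HasScheme.add {N K F C L F' C' L' : ℕ} (h : HasScheme N K F C L)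
    (h' : HasScheme N K F' C' L') : HasScheme N K (F + F') (C + C') (L + L') := by
  obtain ⟨Z, X, hZX⟩ := h
  obtain ⟨Z', X', hZX'⟩ := h'
  refine ⟨fun k W => Fin.append (Z k fun n i => W n (Fin.castAdd F' i))
      (Z' k fun n i => W n (Fin.natAdd F i)),
    fun d W => Fin.append (X d fun n i => W n (Fin.castAdd F' i))
      (X' d fun n i => W n (Fin.natAdd F i)), ?_⟩
  intro d k W W' hZ hX
  have key : ∀ {a b : ℕ} {u u' : Bits a} {v v' : Bits b},
      Fin.append u v = Fin.append u' v' → u = u' ∧ v = v' := by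
    intro a b u u' v v' huv
    constructor
    · ext i; simpa using congrFun huv (Fin.castAdd b i)
    · ext i; simpa using congrFun huv (Fin.natAdd a i)
  have h1 := hZX d k _ _ (key hZ).1 (key hX).1
  have h2 := hZX' d k _ _ (key hZ).2 (key hX).2
  funext i
  refine Fin.addCases (fun i => ?_) (fun i => ?_) i
  · exact congrFun h1 i
  · exact congrFun h2 i

/-- All files are broadcast. -/
theorem HasScheme.uncoded (N K F : ℕ) : HasScheme N K F 0 (N * F) :=
  ⟨fun _ _ => Fin.elim0, fun _ W i => W (finProdFinEquiv.symm i).1 (finProdFinEquiv.symm i).2, by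
    intro d k W W' _ hX
    funext i
    simpa using congrFun hX (finProdFinEquiv (d.1 k, i))⟩

theorem HasScheme.mul {N K F C L : ℕ} (h : HasScheme N K F C L) (q : ℕ) :
    HasScheme N K (q * F) (q * C) (q * L) := by
  induction q with
  | zero => simpa using HasScheme.uncoded N K 0
  | succ q ih => simpa only [Nat.succ_mul] using ih.add h

/-- Memory sharing between two schemes. -/
theorem achievable_of_hasScheme {N K F₁ C₁ L₁ F₂ C₂ L₂ : ℕ} (h₁ : HasScheme N K F₁ C₁ L₁)
    (h₂ : HasScheme N K F₂ C₂ L₂) {a b : ℝ} (ha : 0 ≤ a) (hb : 0 ≤ b)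
    (hab : a * F₁ + b * F₂ = 1) : Achievable N K (a * C₁ + b * C₂) (a * L₁ + b * L₂) := by
  intro ε hε
  -- Rounding down the numbers of copies leaves at most `F₁ + F₂` bits per file; these are sent
  -- uncoded, and `ε * F` pays for them.
  filter_upwards [Filter.eventually_ge_atTop ⌈(N : ℝ) * (F₁ + F₂) / ε⌉₊] with F hF
  have hF' : (N : ℝ) * (F₁ + F₂) ≤ ε * F := by
    have := Nat.ceil_le.1 hF
    rw [div_le_iff₀ hε] at this
    linarith
  set q₁ := ⌊a * F⌋₊
  set q₂ := ⌊b * F⌋₊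
  have hq₁ : (q₁ : ℝ) ≤ a * F := Nat.floor_le (by positivity)
  have hq₂ : (q₂ : ℝ) ≤ b * F := Nat.floor_le (by positivity)
  have hq₁' : a * F < q₁ + 1 := Nat.lt_floor_add_one _
  have hq₂' : b * F < q₂ + 1 := Nat.lt_floor_add_one _
  have hFab : a * F * F₁ + b * F * F₂ = F := by
    linear_combination (F : ℝ) * hab
  have hle : q₁ * F₁ + q₂ * F₂ ≤ F := by
    have : (q₁ : ℝ) * F₁ + q₂ * F₂ ≤ F := by
      calc _ ≤ a * F * F₁ + b * F * F₂ := by gcongr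
        _ = F := hFab
    exact_mod_cast this
  obtain ⟨r, hr⟩ := Nat.exists_eq_add_of_le hle
  have hrle : (r : ℝ) ≤ F₁ + F₂ := by
    have h1 : (F : ℝ) = q₁ * F₁ + q₂ * F₂ + r := by exact_mod_cast hr
    have h2 : a * F * F₁ ≤ (q₁ + 1) * F₁ := by gcongr
    have h3 : b * F * F₂ ≤ (q₂ + 1) * F₂ := by gcongr
    linarith
  refine ⟨q₁ * C₁ + q₂ * C₂ + 0, ?_, ?_⟩
  · push_cast
    calc _ ≤ a * F * C₁ + b * F * C₂ + 0 := by gcongr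
      _ = _ := by ring
  · have hS := ((h₁.mul q₁).add (h₂.mul q₂)).add (HasScheme.uncoded N K r)
    rw [← hr] at hS
    obtain ⟨S, hS⟩ := hS.exists_scheme
    refine ⟨S, fun d => ?_⟩
    rw [hS]
    push_cast
    calc _ ≤ a * F * L₁ + b * F * L₂ + N * (F₁ + F₂) := by gcongr
      _ ≤ a * F * L₁ + b * F * L₂ + ε * F := by gcongr
      _ = _ := by ring

/-! ### Achievability: the two corner points -/

/-- File `n` is cut into the bits `W n i`; user `k` stores all bits but those with `i = k`, and
one bit is broadcast. -/
theorem hasScheme_one_bit (N K : ℕ) : HasScheme N K K (N * (K - 1)) 1 := by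
  refine HasScheme.of_additive (A := Fin K → ZMod 2) (B := ZMod 2)
    (D := fun k => Fin N → {i // i ≠ k} → ZMod 2) (by simp) (by simp) ?_
    (fun k => AddMonoidHom.mk' (fun W n i => W n i) fun _ _ => rfl)
    (fun d => AddMonoidHom.mk' (fun W => ∑ i, W (d.1 i) i) fun _ _ => by
      simp [Finset.sum_add_distrib]) ?_
  · intro k
    simp [Fintype.card_subtype_compl, ← pow_mul, mul_comm]
  · intro d k W hZ hX
    have hZ' : ∀ n i, i ≠ k → W n i = 0 := fun n i hi => congrFun (congrFun hZ n) ⟨i, hi⟩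
    have hX' : ∑ i, W (d.1 i) i = 0 := hX
    rw [Finset.sum_eq_single k (fun i _ hi => hZ' _ _ hi) (by simp)] at hX'
    funext i
    by_cases hi : i = k
    · subst hi; exact hX'
    · exact hZ' _ _ hi

/-- In a field with more than two elements, every nonzero element is a sum of any given positive
number of nonzero elements. -/
theorem exists_ne_zero_sum_eq {𝔽 ι : Type*} [Field 𝔽] (hF : ∀ x y : 𝔽, ∃ z, z ≠ x ∧ z ≠ y)
    {s : Finset ι} (hs : s.Nonempty) {t : 𝔽} (ht : t ≠ 0) :
    ∃ l : ι → 𝔽, (∀ i, l i ≠ 0) ∧ ∑ i ∈ s, l i = t := by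
  classical
  induction hs using Finset.Nonempty.cons_induction generalizing t with
  | singleton a => exact ⟨fun _ => t, fun _ => ht, by simp⟩
  | cons a s ha hs ih =>
    -- Avoiding `t` keeps the remainder `t - z` nonzero for the induction.
    obtain ⟨z, hz0, hzt⟩ := hF 0 t
    obtain ⟨l, hl, hsum⟩ := ih (sub_ne_zero.2 hzt.symm)
    refine ⟨Function.update l a z, fun i => ?_, ?_⟩
    · by_cases hi : i = a
      · subst hi; simpa using hz0
      · simpa [hi] using hl i
    · rw [Finset.sum_cons, Finset.sum_update_of_notMem ha, hsum]
      simp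

/-- The coefficients of the broadcast symbol that user `k` uses for its own part. -/
theorem exists_coefficients {𝔽 : Type*} [Field 𝔽] (hF : ∀ x y : 𝔽, ∃ z, z ≠ x ∧ z ≠ y)
    {N K : ℕ} (d : Demand N K) (k : Fin K) :
    ∃ l : Fin K → 𝔽, (∀ i, l i ≠ 0) ∧
      (∀ n, n ≠ d.1 k → ∑ i with i ≠ k ∧ d.1 i = n, l i = 1) ∧
      ∑ i with i ≠ k ∧ d.1 i = d.1 k, l i ≠ 1 := by
  have h : ∀ n, ∃ l : Fin K → 𝔽, (∀ i, l i ≠ 0) ∧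
      (n ≠ d.1 k → ∑ i with i ≠ k ∧ d.1 i = n, l i = 1) ∧
      (n = d.1 k → ∑ i with i ≠ k ∧ d.1 i = n, l i ≠ 1) := by
    intro n
    by_cases hn : n = d.1 k
    · rcases (Finset.univ.filter fun i => i ≠ k ∧ d.1 i = n).eq_empty_or_nonempty with he | he
      · exact ⟨fun _ => 1, fun _ => one_ne_zero, fun h => absurd hn h, fun _ => by simp [he]⟩
      · obtain ⟨z, hz0, hz1⟩ := hF 0 1
        obtain ⟨l, hl, hsum⟩ := exists_ne_zero_sum_eq hF he hz0
        exact ⟨l, hl, fun h => absurd hn h, fun _ => hsum ▸ hz1⟩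
    -- Some user requests `n`, and it is not `k`, so the sum to be normalised is nonempty.
    · obtain ⟨i, hi⟩ := d.2 n
      obtain ⟨l, hl, hsum⟩ := exists_ne_zero_sum_eq hF
        (s := Finset.univ.filter fun i => i ≠ k ∧ d.1 i = n)
        ⟨i, by simpa [hi] using fun h : i = k => hn (by rw [← hi, h])⟩ (one_ne_zero (α := 𝔽))
      exact ⟨l, hl, fun _ => hsum, fun h => absurd h hn⟩
  choose l hl h1 h2 using h
  have hsum : ∀ n, ∑ i with i ≠ k ∧ d.1 i = n, l (d.1 i) i
      = ∑ i with i ≠ k ∧ d.1 i = n, l n i := fun n =>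
    Finset.sum_congr rfl fun i hi => by rw [(Finset.mem_filter.1 hi).2.2]
  exact ⟨fun i => l (d.1 i) i, fun i => hl _ _, fun n hn => (hsum n).trans (h1 n hn),
    by rw [hsum]; exact h2 _ rfl⟩

/-- The symbol with index `(i, j)`, extended by zero to the diagonal. -/
def symbol {𝔽 : Type} [Field 𝔽] {K : ℕ} (i j : Fin K) :
    ({p : Fin K × Fin K // p.1 ≠ p.2} → 𝔽) →+ 𝔽 :=
  if h : i ≠ j then Pi.evalAddMonoidHom _ ⟨(i, j), h⟩ else 0

theorem symbol_self {𝔽 : Type} [Field 𝔽] {K : ℕ} (i : Fin K)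
    (w : {p : Fin K × Fin K // p.1 ≠ p.2} → 𝔽) : symbol i i w = 0 := by
  simp [symbol]

theorem eq_zero_of_symbol {𝔽 : Type} [Field 𝔽] {K : ℕ}
    (w : {p : Fin K × Fin K // p.1 ≠ p.2} → 𝔽) (h : ∀ i j, i ≠ j → symbol i j w = 0) : w = 0 := by
  funext ⟨⟨i, j⟩, hij⟩
  have := h i j hij
  rwa [symbol, dif_pos hij] at this

/-- Decoding: `a n i j` are the symbols of file `n`, `k` is the user, `r` its reference index. -/
theorem decode_symbols {𝔽 : Type*} [Field 𝔽] {N K : ℕ} (d : Demand N K) (k r : Fin K)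
    (hrk : r ≠ k) (l : Fin K → Fin K → 𝔽) (hl : ∀ i j, l i j ≠ 0)
    (hl1 : ∀ n, n ≠ d.1 k → ∑ i with i ≠ k ∧ d.1 i = n, l k i = 1)
    (hl2 : ∑ i with i ≠ k ∧ d.1 i = d.1 k, l k i ≠ 1)
    (a : Fin N → Fin K → Fin K → 𝔽) (ha : ∀ n i, a n i i = 0)
    (h1 : ∀ n i j, i ≠ k → j ≠ i → j ≠ k → a n i j = 0)
    (h2 : ∀ n j, j ≠ k → a n k j = a n k r)
    (h3 : ∑ n, a n k r = 0)
    (hX : ∀ i, ∑ j, l i j * a (d.1 j) i j = 0) (i j : Fin K) (hij : i ≠ j) :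
    a (d.1 k) i j = 0 := by
  have hk : a (d.1 k) k r = 0 := by
    have h := hX k
    have hsplit : ∑ j, l k j * a (d.1 j) k j
        = ∑ n, (∑ i with i ≠ k ∧ d.1 i = n, l k i) * a n k r := by
      rw [← Finset.sum_filter_add_sum_filter_not Finset.univ (fun j => j ≠ k),
        ← Finset.sum_fiberwise (Finset.univ.filter fun j => j ≠ k) d.1]
      have h0 : ∑ x with ¬ x ≠ k, l k x * a (d.1 x) k x = 0 := by
        refine Finset.sum_eq_zero fun x hx => ?_
        have : x = k := by simpa using hx
        rw [this, ha, mul_zero]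
      rw [h0, add_zero]
      refine Finset.sum_congr rfl fun n _ => ?_
      rw [Finset.sum_mul, Finset.filter_filter]
      refine Finset.sum_congr rfl fun x hx => ?_
      obtain ⟨hxk, hxn⟩ := (Finset.mem_filter.1 hx).2
      rw [hxn, h2 n x hxk]
    rw [hsplit] at h
    -- Subtracting the stored sum cancels every file except the requested one, whose coefficient is
    -- nonzero by `hl2`.
    have hdiff : ∑ n, ((∑ i with i ≠ k ∧ d.1 i = n, l k i) - 1) * a n k r = 0 := by
      simp only [sub_mul, one_mul, Finset.sum_sub_distrib, h, h3, sub_zero]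
    rw [Finset.sum_eq_single (d.1 k) (fun n _ hn => by rw [hl1 n hn, sub_self, zero_mul])
      (by simp)] at hdiff
    exact (mul_eq_zero.1 hdiff).resolve_left (sub_ne_zero.2 hl2)
  by_cases hi : i = k
  · subst hi
    rw [h2 _ _ hij.symm, hk]
  · by_cases hj : j = k
    · subst hj
      -- In the broadcast symbol `i ≠ k`, user `k` lacks only the term of index `j = k`, which
      -- belongs to its own file.
      have h := hX i
      rw [Finset.sum_eq_single j _ (by simp)] at h
      · exact (mul_eq_zero.1 h).resolve_left (hl i j)
      · intro x _ hx
        by_cases hxi : x = i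
        · rw [hxi, ha, mul_zero]
        · rw [h1 _ _ _ hi hxi hx, mul_zero]
    · exact h1 _ _ _ hi hij.symm hj

theorem card_ne_and_ne {K : ℕ} {i r : Fin K} (h : r ≠ i) :
    Nat.card {j : Fin K // j ≠ i ∧ j ≠ r} = K - 2 := by
  rw [Nat.card_eq_fintype_card, Fintype.card_subtype]
  have : (Finset.univ.filter fun j : Fin K => j ≠ i ∧ j ≠ r) = Finset.univ \ {i, r} := by
    ext j; simp
  rw [this, Finset.card_sdiff_of_subset (Finset.subset_univ _), Finset.card_pair h.symm]
  simp

/-- Scheme with coded placement: the files consist of the symbols `(i, j)`, `i ≠ j`, over the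
field with four elements.  User `k` stores the symbols with `i ≠ k` and `j ≠ k`, the differences of
the symbols with `i = k`, and the sum over all files of one of these. -/
theorem hasScheme_two_mul (N K : ℕ) (hK : 2 ≤ K) :
    HasScheme N K (2 * (K * (K - 1))) (2 * (N * (K * (K - 2)) + 1)) (2 * K) := by
  obtain ⟨𝔽, _, _, hcard⟩ : ∃ (𝔽 : Type) (_ : Field 𝔽) (_ : Finite 𝔽), Nat.card 𝔽 = 2 ^ 2 :=
    ⟨GaloisField 2 2, inferInstance, inferInstance, GaloisField.card 2 2 (by norm_num)⟩
  have hF : ∀ x y : 𝔽, ∃ z, z ≠ x ∧ z ≠ y := by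
    classical
    intro x y
    have := Fintype.ofFinite 𝔽
    obtain ⟨z, hz⟩ : ∃ z, z ∉ ({x, y} : Finset 𝔽) := by
      by_contra! h
      have h2 : ({x, y} : Finset 𝔽).card ≤ 2 := Finset.card_le_two
      rw [Finset.eq_univ_iff_forall.2 h, Finset.card_univ, ← Nat.card_eq_fintype_card, hcard] at h2
      omega
    exact ⟨z, by simpa using hz⟩
  have : Nontrivial (Fin K) := Fin.nontrivial_iff_two_le.2 hK
  choose ref href using fun k : Fin K => exists_ne k
  choose l hl hl1 hl2 using fun d k => exists_coefficients hF (N := N) (K := K) d k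
  have hr : ∀ k i : Fin K, (if i = k then ref k else k) ≠ i := by
    intro k i
    split_ifs with h
    · exact h ▸ href i
    · exact fun h' => h h'.symm
  refine HasScheme.of_additive (A := {p : Fin K × Fin K // p.1 ≠ p.2} → 𝔽) (B := Fin K → 𝔽)
    -- For each `i` exactly `K - 2` indices remain: `k` is omitted from the row `i ≠ k`, and the
    -- reference index from the row of differences `i = k`. The last factor holds the sum over
    -- files.
    (D := fun k => ((i : Fin K) → {j // j ≠ i ∧ j ≠ if i = k then ref k else k} → Fin N → 𝔽) × 𝔽)
    ?_ ?_ ?_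
    (fun k => AddMonoidHom.mk' (fun W => (fun i j n => symbol i j (W n)
        - if i = k then symbol k (ref k) (W n) else 0, ∑ n, symbol k (ref k) (W n))) ?_)
    (fun d => AddMonoidHom.mk' (fun W i => ∑ j, l d i j * symbol i j (W (d.1 j))) ?_) ?_
  · have hoff : Nat.card {p : Fin K × Fin K // p.1 ≠ p.2} = K * (K - 1) := by
      rw [Nat.card_eq_fintype_card, Fintype.card_subtype]
      have : (Finset.univ.filter fun p : Fin K × Fin K => p.1 ≠ p.2)
          = (Finset.univ : Finset (Fin K)).offDiag := by ext p; simp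
      rw [this, Finset.offDiag_card, Finset.card_univ, Fintype.card_fin, Nat.mul_sub_one]
    rw [Nat.card_fun, hcard, hoff, ← pow_mul]
  · rw [Nat.card_fun, hcard, Nat.card_fin, ← pow_mul]
  · intro k
    rw [Nat.card_prod, Nat.card_pi]
    simp only [Nat.card_fun, card_ne_and_ne (hr k _), hcard, Nat.card_fin, Finset.prod_const,
      Finset.card_univ, Fintype.card_fin, ← pow_mul, ← pow_add]
    refine le_of_eq (congrArg _ ?_)
    ring
  · intro W W'
    refine Prod.ext ?_ ?_
    · funext i j n
      simp only [Pi.add_apply, map_add, Prod.fst_add]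
      split_ifs <;> ring
    · simp [Finset.sum_add_distrib]
  · intro W W'
    funext i
    simp [Finset.sum_add_distrib, mul_add]
  · intro d k W hZ hX
    have hZ1 : ∀ n i j, j ≠ i → j ≠ (if i = k then ref k else k) →
        symbol i j (W n) - (if i = k then symbol k (ref k) (W n) else 0) = 0 := fun n i j h h' =>
      congrFun (congrFun (congrFun (congrArg Prod.fst hZ) i) ⟨j, h, h'⟩) n
    refine eq_zero_of_symbol _ fun i j hij => ?_
    refine decode_symbols d k (ref k) (href k) (l d) (hl d) (hl1 d k) (hl2 d k)
      (fun n i j => symbol i j (W n)) (fun n i => symbol_self i _) ?_ ?_ (congrArg Prod.snd hZ)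
      (fun i => congrFun hX i) i j hij
    · intro n i j hi hji hjk
      simpa [hi] using hZ1 n i j hji (by simpa [hi] using hjk)
    · intro n j hj
      by_cases hjr : j = ref k
      · rw [hjr]
      · exact sub_eq_zero.1 (by simpa using hZ1 n k j hj (by simpa using hjr))

/-! ### Passage to the limit and the exact tradeoff -/

theorem Achievable.lower_bound {N K : ℕ} {M R : ℝ} (h : Achievable N K M R)
    (hN : 0 < N) (hNK : N ≤ K) (hK : K < 2 * N) :
    (K : ℝ) * N - 1 ≤ K * (M + ((N : ℝ) - 1) * R) := by
  have hN1 : (0 : ℝ) ≤ (N : ℝ) - 1 := by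
    have : (1 : ℝ) ≤ N := by exact_mod_cast hN
    linarith
  refine le_of_forall_pos_le_add fun ε hε => ?_
  -- The slack `δ` in the rate enters the bound with weight `K * (N - 1)`, hence costs at most `ε`.
  set δ : ℝ := ε / (K * N) with hδ
  have hKpos : (0 : ℝ) < K := by exact_mod_cast (by omega : 0 < K)
  have hNpos : (0 : ℝ) < N := by exact_mod_cast hN
  have hδpos : 0 < δ := by positivity
  obtain ⟨F, hF, C, hC, S, hS⟩ := ((Filter.eventually_gt_atTop 0).and (h δ hδpos)).exists
  have hFpos : (0 : ℝ) < F := by exact_mod_cast hF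
  obtain ⟨d₀⟩ : Nonempty (Demand N K) := ⟨cyclicDemand hNK hK ⟨0, by omega⟩⟩
  have hR : 0 ≤ (R + δ) * F := (Nat.cast_nonneg _).trans (hS d₀)
  have hb := S.lower_bound hN hNK hK (L := ⌊(R + δ) * F⌋₊) fun d => Nat.le_floor (hS d)
  have hfl : (⌊(R + δ) * F⌋₊ : ℝ) ≤ (R + δ) * F := Nat.floor_le hR
  have h1 : ((K : ℝ) * N - 1) * F ≤ (K * (M + ((N : ℝ) - 1) * (R + δ))) * F := by
    calc _ ≤ (K : ℝ) * (C + ((N : ℝ) - 1) * ⌊(R + δ) * F⌋₊) := hb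
      _ ≤ K * (M * F + ((N : ℝ) - 1) * ((R + δ) * F)) := by gcongr
      _ = _ := by ring
  have h2 := le_of_mul_le_mul_right h1 hFpos
  have h3 : (K : ℝ) * (((N : ℝ) - 1) * δ) ≤ K * (N * δ) := by gcongr; linarith
  have h4 : (K : ℝ) * (N * δ) = ε := by rw [hδ]; field_simp
  linarith

end CodedCaching

theorem mainTheorem3 (N K : ℕ) (hK : 2 ≤ K)
    (hN : ⌈((K : ℝ) + 1) / 2⌉₊ ≤ N) (hNK : N ≤ K) (M : ℝ)
    (hM₁ : (N : ℝ) / K * (K - 2 + (K - 2 + 1 / (N : ℝ)) / (K - 1)) ≤ M)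
    (hM₂ : M ≤ (N : ℝ) * (K - 1) / K) :
    CodedCaching.IsExactTradeoff N K M
      (((K : ℝ) * N - 1) / (K * (N - 1)) - 1 / ((N : ℝ) - 1) * M) := by
  have hKN : K + 1 ≤ 2 * N := by
    have := Nat.ceil_le.1 hN
    have : (K : ℝ) + 1 ≤ 2 * N := by linarith
    exact_mod_cast this
  have hK' : (2 : ℝ) ≤ K := by exact_mod_cast hK
  have hN' : (2 : ℝ) ≤ N := by exact_mod_cast (by omega : 2 ≤ N)
  have hK0 : (K : ℝ) ≠ 0 := by linarith
  have hK1 : (K : ℝ) - 1 ≠ 0 := by linarith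
  have hN0 : (N : ℝ) ≠ 0 := by linarith
  have hN1 : (N : ℝ) - 1 ≠ 0 := by linarith
  have hN1' : (0 : ℝ) < (N : ℝ) - 1 := by linarith
  constructor
  · have hM₁' : N * (K * ((K : ℝ) - 2)) + 1 ≤ M * (K * (K - 1)) := by
      have : (N : ℝ) / K * (K - 2 + (K - 2 + 1 / (N : ℝ)) / (K - 1))
          = (N * (K * ((K : ℝ) - 2)) + 1) / (K * (K - 1)) := by
        field_simp
        ring
      rw [this, div_le_iff₀ (by nlinarith)] at hM₁
      exact hM₁
    have hach := CodedCaching.achievable_of_hasScheme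
      (CodedCaching.hasScheme_two_mul N K hK) (CodedCaching.hasScheme_one_bit N K)
      -- The convex weights placing `M` between the two endpoints, divided by the file sizes `2 * (K
      -- * (K - 1))` and `K`; the endpoints are `(N - 1) / (K * (K - 1))` apart.
      (a := (N * (K - 1) / K - M) / (2 * (N - 1)))
      (b := (M * (K * (K - 1)) - (N * (K * ((K : ℝ) - 2)) + 1)) / (K * (N - 1)))
      (div_nonneg (by linarith) (by linarith))
      (div_nonneg (by linarith) (by positivity))
      (by
        push_cast [Nat.cast_sub (by omega : 1 ≤ K)]
        field_simp
        ring)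
    change CodedCaching.Achievable _ _ _ _
    convert hach using 1
    · push_cast [Nat.cast_sub (by omega : 1 ≤ K), Nat.cast_sub hK]
      field_simp
      ring
    · push_cast
      field_simp
      ring
  · intro R hR
    have h := CodedCaching.Achievable.lower_bound hR (by omega) hNK (by omega)
    have : (K : ℝ) * (N - 1) * (((K : ℝ) * N - 1) / (K * (N - 1)) - 1 / ((N : ℝ) - 1) * M)
        ≤ K * (N - 1) * R := by
      have : (K : ℝ) * (N - 1) * (((K : ℝ) * N - 1) / (K * (N - 1)) - 1 / ((N : ℝ) - 1) * M)
          = K * N - 1 - K * M := by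
        field_simp
      linarith
    exact le_of_mul_le_mul_left this (by positivity)
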